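/- Consider a $K$-user interference network ($K\ge 1$) with an arbitrary topology, i.e. a relation "transmitter $i$ is connected to receiver $j$" on $[K]=\{1,\dots,K\}$ under which each transmitter $i$ is connected to its own receiver $i$. Let $I_j=\{i\ne j:\ \text{transmitter } i \text{ is connected to receiver } j\}$ be the set of interferers at receiver $j$. The channel is time-varying: for every $n$, the coefficients $h_{ij}(t)$ of all connected pairs $(i,j)$ in the time slots $t=1,\dots,n$ are random with a jointly continuous distribution (absolutely continuous with respect to Lebesgue measure). Let $\Lambda_{ij}=\mathrm{diag}(h_{ij}(1),\dots,h_{ij}(n))$. The transmitters know only the topology: the channel law is an unspecified member of a nonempty class $\mathcal L$ of such laws (for example a single law, or all of them), and the transmitters know neither this law beyond its membership in $\mathcal L$ nor the channel realization. A tuple $(d_1,\dots,d_K)$ of linear degrees of freedom (LDoF) is achievable if there are $n\ge 1$, integers $m_i\ge 0$ with $d_i=m_i/n$, and fixed real precoding matrices $B_i$ of size $n\times m_i$ such that, for every law in $\mathcal L$, almost surely for every receiver $j$ the orthogonal projection of $\mathrm{colspan}(\Lambda_{jj}B_j)$ onto the orthogonal complement of $\sum_{i\in I_j}\mathrm{colspan}(\Lambda_{ij}B_i)$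 has dimension $m_j$. Let $\mathrm{LDoF}_{\mathrm{sym}}$ be the supremum of all $d$ such that $(d,\dots,d)$ is achievable. The reduced conflict graph of the network is the directed graph on $[K]$ with an arc $i\to j$ if and only if $i\ne j$, transmitter $i$ is connected to receiver $j$, and there are $s,k\in[K]\setminus\{i\}$ with $s\ne k$ such that transmitters $i$ and $s$ are both connected to receiver $k$. It is called bipartite if $[K]$ can be split into two classes such that every arc joins the two classes. Then half linear symmetric degrees of freedom are achievable if and only if the reduced conflict graph is bipartite. This holds in both senses: $\mathrm{LDoF}_{\mathrm{sym}}\ge \tfrac12$ if and only if the reduced conflict graph is bipartite, and the tuple $(\tfrac12,\dots,\tfrac12)$ is achievable if and only if the reduced conflict graph is bipartite. -/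

import Mathlib

open MeasureTheory

/-- A topology of a `K`-user interference network: `Conn i j` says that transmitter `i` is
connected to (that is, heard at) receiver `j`.  Every transmitter is connected to its own
receiver; apart from this the pattern is arbitrary. -/
structure NetworkTopology (K : ℕ) where
  Conn : Fin K → Fin K → Prop
  direct : ∀ i, Conn i i

namespace NetworkTopology

variable {K : ℕ}

/-- The transmitters interfering at receiver `j`. -/
def interferers (T : NetworkTopology K) (j : Fin K) : Set (Fin K) :=
  {i | i ≠ j ∧ T.Conn i j}

/-- The links of the network, as pairs (transmitter, receiver). -/
abbrev Link (T : NetworkTopology K) : Type :=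
  {p : Fin K × Fin K // T.Conn p.1 p.2}

noncomputable instance (T : NetworkTopology K) : Fintype T.Link := Fintype.ofFinite _

/-- The reduced conflict graph. -/
def reducedConflictGraph (T : NetworkTopology K) : Digraph (Fin K) where
  Adj i j := i ≠ j ∧ T.Conn i j ∧
    ∃ s k : Fin K, s ≠ i ∧ k ≠ i ∧ s ≠ k ∧ T.Conn i k ∧ T.Conn s k

end NetworkTopology

/-- A directed graph is bipartite if its vertices can be split into two classes such that every
arc, whatever its direction, joins the two classes. -/
def Digraph.IsBipartite {V : Type*} (G : Digraph V) : Prop :=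
  G.toSimpleGraphInclusive.IsBipartite

/-- A realization of the channel: `h i j t` is the channel coefficient between transmitter `i` and
receiver `j` in time slot `t`. -/
abbrev ChannelRealization (K : ℕ) : Type := Fin K → Fin K → ℕ → ℝ

/-- The diagonal matrix of the channel coefficients between transmitter `i` and receiver `j` in
the first `n` time slots. -/
def channelMatrix {K : ℕ} (h : ChannelRealization K) (n : ℕ) (i j : Fin K) :
    Matrix (Fin n) (Fin n) ℝ :=
  Matrix.diagonal fun t => h i j t

/-- The span of the columns of a matrix, in Euclidean space. -/
def colspan {n m : ℕ} (A : Matrix (Fin n) (Fin m) ℝ) : Submodule ℝ (EuclideanSpace ℝ (Fin n)) :=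
  Submodule.span ℝ (Set.range fun c : Fin m => WithLp.toLp 2 fun t : Fin n => A t c)

namespace NetworkTopology

variable {K : ℕ}

/-- A channel law of a time-varying network: a probability measure on channel realizations for
which, for every `n`, the coefficients of all links of the network in the first `n` time slots have
a joint density with respect to Lebesgue measure. Coefficients of pairs that are not linked do
not matter. -/
structure IsContinuousLaw (T : NetworkTopology K) (P : Measure (ChannelRealization K)) : Prop where
  isProbabilityMeasure : IsProbabilityMeasure P
  absolutelyContinuous : ∀ n : ℕ,
    P.map (fun h (x : T.Link × Fin n) => h x.1.1.1 x.1.1.2 x.2) ≪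
      (volume : Measure (T.Link × Fin n → ℝ))

/-- The subspace spanned by the interference at receiver `j`. -/
def interferenceSpace (T : NetworkTopology K) (h : ChannelRealization K) {n : ℕ} {m : Fin K → ℕ}
    (B : (i : Fin K) → Matrix (Fin n) (Fin (m i)) ℝ) (j : Fin K) :
    Submodule ℝ (EuclideanSpace ℝ (Fin n)) :=
  ⨆ i ∈ T.interferers j, colspan (channelMatrix h n i j * B i)

/-- Receiver `j` can decode its `m j` symbols: the projection of the space of its desired signal
onto the orthogonal complement of the interference space has dimension `m j`. -/
def Decodable (T : NetworkTopology K) (h : ChannelRealization K) {n : ℕ} {m : Fin K → ℕ}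
    (B : (i : Fin K) → Matrix (Fin n) (Fin (m i)) ℝ) (j : Fin K) : Prop :=
  Module.finrank ℝ
    ((colspan (channelMatrix h n j j * B j)).map
      ((T.interferenceSpace h B j)ᗮ.starProjection :
        EuclideanSpace ℝ (Fin n) →ₗ[ℝ] EuclideanSpace ℝ (Fin n))) = m j

/-- The tuple `d` of linear degrees of freedom is achievable without channel knowledge at the
transmitters: there are `n ≥ 1` time slots and fixed precoding matrices `B i` of size `n × m i`,
with `d i = m i / n`, such that, whichever law in the class `𝓛` the channel has, almost surely all
receivers can decode. The transmitters know neither the realization of the channel nor which law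
in `𝓛` it has; `𝓛` may consist of a single law or of all continuous laws. -/
def LDoFAchievable (T : NetworkTopology K) (𝓛 : Set (Measure (ChannelRealization K)))
    (d : Fin K → ℝ) : Prop :=
  ∃ (n : ℕ) (m : Fin K → ℕ) (B : (i : Fin K) → Matrix (Fin n) (Fin (m i)) ℝ),
    0 < n ∧ (∀ i, d i = (m i : ℝ) / (n : ℝ)) ∧
      ∀ P ∈ 𝓛, ∀ᵐ h ∂P, ∀ j, T.Decodable h B j

/-- The linear symmetric degrees of freedom: the supremum of all `d` for which the tuple
`(d, …, d)` is achievable. For `K ≥ 1` and a nonempty class of probability laws these `d` lie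
between `0` and `1`, and `0` is one of them. -/
noncomputable def LDoFsym (T : NetworkTopology K) (𝓛 : Set (Measure (ChannelRealization K))) : ℝ :=
  sSup {d : ℝ | T.LDoFAchievable 𝓛 fun _ => d}

end NetworkTopology

/-! Achievability: with a 2-colouring, two slots and one symbol per transmitter suffice. At each
receiver the interference occupies a single line that almost surely misses the desired signal
(`ldofAchievable_half`).

Converse: each precoder's column space `V` defines a linear matroid on the time slots, with rank
function `coordRank`. Under generic diagonal scalings, the sum of two spaces has dimension at least
`coordRank V S + coordRank W Sᶜ` for every set `S` of slots (`ae_coordRank_add_le_finrank_sup`). If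
`n = 2 * m + δ`, two interferers at a common receiver may span at most `m + δ` dimensions. Hence
each is, up to `O(δ)`, the coordinate space of any of its bases, and their bases nearly coincide. A
desired signal and an interferer must be independent, so if both are nearly coordinate spaces, their
bases are nearly complementary.

Fix a basis `U i` for each transmitter. These relations fail in at most `11 * δ` slots per pair, so
for small `δ / n` some slot `t` satisfies them all, and membership `t ∈ U i` yields the 2-colouring
(`isBipartite_of_slot`). As this tolerates a small positive `δ`, it also settles the supremum. -/

/-! ### Generic nonvanishing and linear independence. -/

theorem MvPolynomial.ae_eval_ne_zero_fin : ∀ {n : ℕ} (p : MvPolynomial (Fin n) ℝ), p ≠ 0 →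
    ∀ᵐ x : Fin n → ℝ, MvPolynomial.eval x p ≠ 0
  | 0, p, hp => by
    refine Filter.Eventually.of_forall fun x hx => hp ?_
    apply MvPolynomial.funext
    intro y
    rw [Subsingleton.elim y x, hx, map_zero]
  | n + 1, p, hp => by
    have hq : MvPolynomial.finSuccEquiv ℝ n p ≠ 0 := by simpa using hp
    set q := MvPolynomial.finSuccEquiv ℝ n p with hq_def
    -- Fubini: for almost every value of the other variables the leading coefficient in the first
    -- one survives, leaving finitely many roots.
    have ih := ae_eval_ne_zero_fin q.leadingCoeff (Polynomial.leadingCoeff_ne_zero.mpr hq)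
    have hmeas : MeasurableSet {z : (Fin n → ℝ) × ℝ |
        MvPolynomial.eval (Fin.cons z.2 z.1 : Fin (n + 1) → ℝ) p ≠ 0} := by
      have hc : Continuous fun z : (Fin n → ℝ) × ℝ =>
          MvPolynomial.eval (Fin.cons z.2 z.1 : Fin (n + 1) → ℝ) p := by
        apply (MvPolynomial.continuous_eval p).comp
        exact Continuous.finCons continuous_snd continuous_fst
      exact (isOpen_ne.preimage hc).measurableSet
    have hprod : ∀ᵐ z : (Fin n → ℝ) × ℝ,
        MvPolynomial.eval (Fin.cons z.2 z.1 : Fin (n + 1) → ℝ) p ≠ 0 := by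
      rw [Measure.volume_eq_prod, Measure.ae_prod_iff_ae_ae hmeas]
      filter_upwards [ih] with s hs
      have hne : q.map (MvPolynomial.eval s) ≠ 0 := by
        intro h0
        apply hs
        have := congrArg (fun r => r.coeff q.natDegree) h0
        simpa [Polynomial.coeff_map] using this
      have hfin : {y : ℝ | (q.map (MvPolynomial.eval s)).IsRoot y}.Finite :=
        Polynomial.finite_setOfPred_isRoot hne
      filter_upwards [hfin.countable.ae_notMem volume] with y hy h0
      apply hy
      rw [MvPolynomial.eval_eq_eval_mv_eval'] at h0
      exact h0
    have hmp := (volume_preserving_piFinSuccAbove (fun _ : Fin (n + 1) => ℝ) 0)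
    have hsw : MeasurePreserving (Prod.swap : ℝ × (Fin n → ℝ) → (Fin n → ℝ) × ℝ) volume volume :=
      Measure.measurePreserving_swap
    have := (hsw.comp hmp).quasiMeasurePreserving.ae hprod
    filter_upwards [this] with x hx
    have hx' : (Fin.cons (x 0) (fun i : Fin n => x i.succ) : Fin (n + 1) → ℝ) = x :=
      Fin.cons_self_tail x
    rw [← hx']
    exact hx

/-- A nonzero real polynomial in finitely many variables vanishes almost nowhere. -/
theorem MvPolynomial.ae_eval_ne_zero {ι : Type*} [Fintype ι] (p : MvPolynomial ι ℝ) (hp : p ≠ 0) :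
    ∀ᵐ x : ι → ℝ, MvPolynomial.eval x p ≠ 0 := by
  let e := Fintype.equivFin ι
  have h := MvPolynomial.ae_eval_ne_zero_fin (MvPolynomial.rename e p)
    (by simpa using (MvPolynomial.rename_injective e e.injective).ne hp)
  have hmp := volume_measurePreserving_piCongrLeft (fun _ : Fin (Fintype.card ι) => ℝ) e
  filter_upwards [hmp.quasiMeasurePreserving.ae h] with x hx
  rw [MvPolynomial.eval_rename] at hx
  convert hx using 3
  ext i
  exact (Equiv.piCongrLeft_apply_apply (fun _ : Fin (Fintype.card ι) => ℝ) e x i).symm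

/-- If vectors whose coordinates are scaled by variables are linearly independent for one value of
the variables, then they are so for almost every value. -/
theorem ae_linearIndependent_smul {κ ι : Type*} [Finite κ] [Fintype ι] {n : ℕ}
    (v : κ → EuclideanSpace ℝ (Fin n)) (a : κ → Fin n → ι) (x₀ : ι → ℝ)
    (h : LinearIndependent ℝ fun k =>
      (WithLp.toLp 2 fun t => x₀ (a k t) * v k t : EuclideanSpace ℝ (Fin n))) :
    ∀ᵐ x : ι → ℝ, LinearIndependent ℝ fun k =>
      (WithLp.toLp 2 fun t => x (a k t) * v k t : EuclideanSpace ℝ (Fin n)) := by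
  classical
  have := Fintype.ofFinite κ
  -- A left inverse `g` at `x₀` turns independence into a determinant: it is polynomial in `x` and
  -- equals 1 at `x₀`.
  obtain ⟨g, hg⟩ := (Fintype.linearCombination ℝ fun k =>
    (WithLp.toLp 2 fun t => x₀ (a k t) * v k t :
      EuclideanSpace ℝ (Fin n))).exists_leftInverse_of_injective
        (LinearMap.ker_eq_bot.mpr h.fintypeLinearCombination_injective)
  let M : Matrix κ κ (MvPolynomial ι ℝ) := fun k l =>
    ∑ t, MvPolynomial.C (v k t * g (EuclideanSpace.single t 1) l) * MvPolynomial.X (a k t)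
  have hM : ∀ x : ι → ℝ, (MvPolynomial.eval x).mapMatrix M = Matrix.of fun k =>
      g (WithLp.toLp 2 fun t => x (a k t) * v k t) := by
    intro x
    ext k l
    have hu : (WithLp.toLp 2 fun t => x (a k t) * v k t : EuclideanSpace ℝ (Fin n)) =
        ∑ t, (x (a k t) * v k t) • EuclideanSpace.single t (1 : ℝ) := by
      ext t
      simp [Finset.sum_apply, Pi.single_apply]
    rw [RingHom.mapMatrix_apply, Matrix.map_apply, Matrix.of_apply, hu]
    simp [M, Finset.sum_apply]
    exact Finset.sum_congr rfl fun t _ => by ring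
  have hdet : ∀ x : ι → ℝ, MvPolynomial.eval x M.det = (Matrix.of fun k =>
      g (WithLp.toLp 2 fun t => x (a k t) * v k t)).det := by
    intro x
    rw [← hM, RingHom.map_det]
  have hne : M.det ≠ 0 := by
    intro h0
    have h1 := hdet x₀
    have h2 : (Matrix.of fun k => g (WithLp.toLp 2 fun t => x₀ (a k t) * v k t)) = 1 := by
      ext k l
      have := congrFun (LinearMap.congr_fun hg (Pi.single k 1)) l
      simpa [Pi.single_apply, Matrix.one_apply, eq_comm] using this
    rw [h0, h2] at h1
    simp at h1
  filter_upwards [MvPolynomial.ae_eval_ne_zero _ hne] with x hx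
  rw [hdet] at hx
  exact LinearIndependent.of_comp g (Matrix.linearIndependent_rows_of_det_ne_zero hx)

namespace NetworkTopology

variable {K : ℕ} {T : NetworkTopology K} {P : Measure (ChannelRealization K)}

/-- What holds for almost all coefficients of the links holds almost surely for the channel. -/
theorem IsContinuousLaw.ae_link (hP : T.IsContinuousLaw P) {n : ℕ}
    {p : (T.Link × Fin n → ℝ) → Prop} (hp : ∀ᵐ x, p x) :
    ∀ᵐ h ∂P, p fun x => h x.1.1.1 x.1.1.2 x.2 := by
  have hm : Measurable fun (h : ChannelRealization K) (x : T.Link × Fin n) =>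
      h x.1.1.1 x.1.1.2 x.2 := by fun_prop
  exact ae_of_ae_map hm.aemeasurable ((hP.absolutelyContinuous n).ae_le hp)

end NetworkTopology

/-! ### The matroid of a subspace on the coordinates, and generic sums. -/

/-- Coordinatewise multiplication by a fixed vector. -/
def diagMap {n : ℕ} (x : Fin n → ℝ) :
    EuclideanSpace ℝ (Fin n) →ₗ[ℝ] EuclideanSpace ℝ (Fin n) where
  toFun v := WithLp.toLp 2 fun t => x t * v t
  map_add' u v := by ext t; simp [mul_add]
  map_smul' c v := by ext t; simp [mul_left_comm]

@[simp]
theorem diagMap_apply {n : ℕ} (x : Fin n → ℝ) (v : EuclideanSpace ℝ (Fin n)) (t : Fin n) :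
    diagMap x v t = x t * v t := rfl

theorem diagMap_injective {n : ℕ} {x : Fin n → ℝ} (hx : ∀ t, x t ≠ 0) :
    Function.Injective (diagMap x) := by
  intro u v huv
  ext t
  have := congrArg (fun w : EuclideanSpace ℝ (Fin n) => w t) huv
  simpa [hx t] using this

theorem colspan_diagonal_mul {n m : ℕ} (x : Fin n → ℝ) (B : Matrix (Fin n) (Fin m) ℝ) :
    colspan (Matrix.diagonal x * B) = (colspan B).map (diagMap x) := by
  rw [colspan, colspan, Submodule.map_span, ← Set.range_comp]
  congr 2
  ext c t
  simp [Matrix.diagonal_mul]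

theorem finrank_colspan_le {n m : ℕ} (B : Matrix (Fin n) (Fin m) ℝ) :
    Module.finrank ℝ (colspan B) ≤ m :=
  (finrank_range_le_card (R := ℝ) fun c : Fin m =>
    (WithLp.toLp 2 fun t : Fin n => B t c : EuclideanSpace ℝ (Fin n))).trans_eq (Fintype.card_fin m)

/-- The projection onto the coordinates in `S`. -/
def coordProj {n : ℕ} (S : Finset (Fin n)) :
    EuclideanSpace ℝ (Fin n) →ₗ[ℝ] EuclideanSpace ℝ (Fin n) :=
  diagMap fun t => if t ∈ S then 1 else 0

@[simp]
theorem coordProj_apply {n : ℕ} (S : Finset (Fin n)) (v : EuclideanSpace ℝ (Fin n)) (t : Fin n) :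
    coordProj S v t = if t ∈ S then v t else 0 := by
  simp [coordProj]

/-- The dimension of the projection of `V` onto the coordinates in `S`: the rank function of the
linear matroid that `V` defines on the coordinates. -/
noncomputable def coordRank {n : ℕ} (V : Submodule ℝ (EuclideanSpace ℝ (Fin n)))
    (S : Finset (Fin n)) : ℕ :=
  Module.finrank ℝ (V.map (coordProj S))

section coordRank

variable {n : ℕ} (V W : Submodule ℝ (EuclideanSpace ℝ (Fin n))) {S U I J : Finset (Fin n)}

theorem coordRank_univ : coordRank V Finset.univ = Module.finrank ℝ V := by
  have : coordProj (Finset.univ : Finset (Fin n)) = LinearMap.id := by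
    ext v t
    simp
  rw [coordRank, this, Submodule.map_id]

theorem coordRank_mono (h : S ⊆ U) : coordRank V S ≤ coordRank V U := by
  have : coordProj S = (coordProj S).comp (coordProj U) := by
    apply LinearMap.ext
    intro v
    ext t
    by_cases ht : t ∈ S
    · simp [ht, h ht]
    · simp [ht]
  rw [coordRank, this, Submodule.map_comp]
  exact Submodule.finrank_map_le _ _

theorem coordRank_union_le (S U : Finset (Fin n)) :
    coordRank V (S ∪ U) ≤ coordRank V S + coordRank V U := by
  have h : V.map (coordProj (S ∪ U)) ≤ V.map (coordProj S) ⊔ V.map (coordProj (U \ S)) := by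
    rintro _ ⟨v, hv, rfl⟩
    refine Submodule.mem_sup.mpr ⟨_, Submodule.mem_map_of_mem hv, _, Submodule.mem_map_of_mem hv, ?_⟩
    ext t
    by_cases h1 : t ∈ S <;> simp [h1]
  calc coordRank V (S ∪ U) ≤ _ := Submodule.finrank_mono h
    _ ≤ coordRank V S + coordRank V (U \ S) := Submodule.finrank_add_le_finrank_add_finrank _ _
    _ ≤ _ := by gcongr; exact coordRank_mono V Finset.sdiff_subset

theorem finrank_le_card_of_support (h : ∀ v ∈ V, ∀ t ∉ S, v t = 0) :
    Module.finrank ℝ V ≤ S.card := by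
  classical
  have hV : V ≤ Submodule.span ℝ
      ((S.image fun t => EuclideanSpace.single t (1 : ℝ) : Finset (EuclideanSpace ℝ (Fin n))) :
        Set (EuclideanSpace ℝ (Fin n))) := by
    intro v hv
    have : v = ∑ t ∈ S, v t • EuclideanSpace.single t (1 : ℝ) := by
      ext t
      by_cases ht : t ∈ S
      · simp [Finset.sum_apply, Pi.single_apply, ht]
      · simp [Finset.sum_apply, Pi.single_apply, ht, h v hv t ht]
    rw [this]
    refine Submodule.sum_mem _ fun t ht => Submodule.smul_mem _ _ (Submodule.subset_span ?_)
    exact Finset.mem_coe.mpr (Finset.mem_image_of_mem _ ht)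
  exact (Submodule.finrank_mono hV).trans ((finrank_span_finset_le_card _).trans
    Finset.card_image_le)

theorem coordRank_le_card (S : Finset (Fin n)) : coordRank V S ≤ S.card := by
  apply finrank_le_card_of_support
  rintro _ ⟨v, -, rfl⟩ t ht
  simp [ht]

variable {V}

theorem coordRank_eq_card_of_subset (hJ : coordRank V J = J.card) (h : I ⊆ J) :
    coordRank V I = I.card := by
  have h1 := coordRank_union_le V I (J \ I)
  rw [Finset.union_sdiff_of_subset h] at h1
  have h2 := coordRank_le_card V (J \ I)
  have h3 := coordRank_le_card V I
  have h4 := Finset.card_sdiff_add_card_eq_card h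
  omega

/-- The image of `v` in the larger projection is a nonzero vector killed by forgetting `t`, so
rank-nullity gives a strict drop. -/
theorem coordRank_lt_insert {v : EuclideanSpace ℝ (Fin n)} (hv : v ∈ V) {t : Fin n}
    (ht : v t ≠ 0) (hI : coordProj I v = 0) : coordRank V I < coordRank V (insert t I) := by
  have hcomp : (coordProj I).comp (coordProj (insert t I)) = coordProj I := by
    apply LinearMap.ext
    intro v
    ext s
    by_cases hs : s ∈ I <;> simp [hs]
  have h1 : V.map (coordProj I) = (V.map (coordProj (insert t I))).map (coordProj I) := by
    rw [← Submodule.map_comp, hcomp]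
  have h2 := LinearMap.finrank_range_add_finrank_ker
    ((coordProj I).domRestrict (V.map (coordProj (insert t I))))
  rw [LinearMap.range_domRestrict, ← h1] at h2
  have h3 : 0 < Module.finrank ℝ
      (LinearMap.ker ((coordProj I).domRestrict (V.map (coordProj (insert t I))))) := by
    rw [Module.finrank_pos_iff_exists_ne_zero]
    refine ⟨⟨⟨_, Submodule.mem_map_of_mem hv⟩, ?_⟩, ?_⟩
    · rw [LinearMap.mem_ker, LinearMap.domRestrict_apply, ← LinearMap.comp_apply, hcomp, hI]
    · intro h0
      apply ht
      have := congrArg (fun w => (w : EuclideanSpace ℝ (Fin n)) t)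
        (congrArg (fun w => (w.1 : EuclideanSpace ℝ (Fin n))) h0)
      simpa using this
  unfold coordRank
  omega

/-- If no single coordinate raised the rank, every vector of `V` vanishing on `I` would vanish on
`S`, and comparing kernels would contradict `h`. -/
theorem exists_coordRank_lt_insert (h : coordRank V I < coordRank V S) :
    ∃ t ∈ S, coordRank V I < coordRank V (insert t I) := by
  by_contra! hc
  have hker : ∀ v ∈ V, coordProj I v = 0 → coordProj S v = 0 := by
    intro v hv hI
    ext t
    by_cases ht : t ∈ S
    · by_contra hne
      simp only [coordProj_apply, ht, if_true] at hne
      exact absurd (coordRank_lt_insert hv hne hI) (not_lt.mpr (hc t ht))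
    · simp [ht]
  have h1 := LinearMap.finrank_range_add_finrank_ker ((coordProj I).domRestrict V)
  have h2 := LinearMap.finrank_range_add_finrank_ker ((coordProj S).domRestrict V)
  rw [LinearMap.range_domRestrict] at h1 h2
  have h3 : LinearMap.ker ((coordProj I).domRestrict V) ≤
      LinearMap.ker ((coordProj S).domRestrict V) := fun v hv => hker v v.2 hv
  have h4 := Submodule.finrank_mono h3
  unfold coordRank at h
  omega

/-- Basis extension in the matroid defined by `V`. -/
theorem exists_basis_superset (hI : coordRank V I = I.card) (h : I ⊆ S) :
    ∃ J, I ⊆ J ∧ J ⊆ S ∧ coordRank V J = J.card ∧ coordRank V J = coordRank V S := by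
  induction hk : coordRank V S - coordRank V I generalizing I with
  | zero => exact ⟨I, subset_rfl, h, hI, le_antisymm (coordRank_mono V h) (by omega)⟩
  | succ k ih =>
    obtain ⟨t, ht, hlt⟩ := exists_coordRank_lt_insert (V := V) (I := I) (S := S) (by omega)
    have hle := coordRank_le_card V (insert t I)
    have hcard := Finset.card_insert_le t I
    obtain ⟨J, hJ, hJ'⟩ := ih (I := insert t I) (by omega) (Finset.insert_subset ht h) (by omega)
    exact ⟨J, (Finset.subset_insert t I).trans hJ, hJ'⟩

theorem exists_basis (V : Submodule ℝ (EuclideanSpace ℝ (Fin n))) (S : Finset (Fin n)) :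
    ∃ J ⊆ S, coordRank V J = J.card ∧ coordRank V J = coordRank V S := by
  have h0 : coordRank V ∅ = (∅ : Finset (Fin n)).card := by
    simpa using coordRank_le_card V ∅
  obtain ⟨J, -, h⟩ := exists_basis_superset h0 (Finset.empty_subset S)
  exact ⟨J, h⟩

/-- Coordinates outside `U` bound the dimension of a sum of scaled subspaces. -/
theorem finrank_sup_map_diagMap_le (V W : Submodule ℝ (EuclideanSpace ℝ (Fin n)))
    (x y : Fin n → ℝ) (U : Finset (Fin n)) :
    Module.finrank ℝ ↥(V.map (diagMap x) ⊔ W.map (diagMap y)) ≤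
      U.card + coordRank V Uᶜ + coordRank W Uᶜ := by
  set Z := V.map (diagMap x) ⊔ W.map (diagMap y)
  have h1 := coordRank_union_le Z U Uᶜ
  rw [Finset.union_compl, coordRank_univ] at h1
  have h2 := coordRank_le_card Z U
  have hcomm : ∀ (x : Fin n → ℝ) (V : Submodule ℝ (EuclideanSpace ℝ (Fin n))),
      (V.map (diagMap x)).map (coordProj Uᶜ) = (V.map (coordProj Uᶜ)).map (diagMap x) := by
    intro x V
    rw [← Submodule.map_comp, ← Submodule.map_comp]
    congr 1
    apply LinearMap.ext
    intro v
    ext t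
    by_cases ht : t ∈ U <;> simp [ht]
  have h3 : coordRank Z Uᶜ ≤ coordRank V Uᶜ + coordRank W Uᶜ := by
    rw [coordRank, Submodule.map_sup, hcomm, hcomm]
    refine (Submodule.finrank_add_le_finrank_add_finrank _ _).trans ?_
    exact add_le_add (Submodule.finrank_map_le _ _) (Submodule.finrank_map_le _ _)
  omega

end coordRank

/-- For almost all scalings, the sum of two scaled subspaces is at least as large as the matroid
union bound for any splitting of the coordinates. -/
theorem ae_coordRank_add_le_finrank_sup {ι : Type*} [Fintype ι] {n : ℕ}
    (V W : Submodule ℝ (EuclideanSpace ℝ (Fin n))) (a b : Fin n → ι) (S : Finset (Fin n))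
    (x₀ : ι → ℝ) (ha : ∀ t, x₀ (a t) = if t ∈ S then 1 else 0)
    (hb : ∀ t, x₀ (b t) = if t ∈ Sᶜ then 1 else 0) :
    ∀ᵐ x : ι → ℝ, coordRank V S + coordRank W Sᶜ ≤
      Module.finrank ℝ ↥(V.map (diagMap (x ∘ a)) ⊔ W.map (diagMap (x ∘ b))) := by
  -- At `x₀` the scalings are the coordinate projections to `S` and `Sᶜ`, whose images are
  -- independent; lifts of bases of these images stay independent for almost every scaling.
  let e := Module.finBasis ℝ (V.map (coordProj S))
  let f := Module.finBasis ℝ (W.map (coordProj Sᶜ))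
  choose v hvV hv using fun k => (e k).2
  choose w hwW hw using fun k => (f k).2
  have hLI : LinearIndependent ℝ fun k => (WithLp.toLp 2 fun t =>
      x₀ (Sum.elim (fun _ => a) (fun _ => b) k t) * (Sum.elim v w k) t :
        EuclideanSpace ℝ (Fin n)) := by
    have he : LinearIndependent ℝ fun k => (e k : EuclideanSpace ℝ (Fin n)) :=
      e.linearIndependent.map' (Submodule.subtype _) (Submodule.ker_subtype _)
    have hf : LinearIndependent ℝ fun k => (f k : EuclideanSpace ℝ (Fin n)) :=
      f.linearIndependent.map' (Submodule.subtype _) (Submodule.ker_subtype _)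
    have hdisj : Disjoint (V.map (coordProj S)) (W.map (coordProj Sᶜ)) := by
      rw [Submodule.disjoint_def]
      rintro _ ⟨v, -, rfl⟩ ⟨w, -, hvw⟩
      ext t
      have := congrArg (fun u : EuclideanSpace ℝ (Fin n) => u t) hvw
      by_cases ht : t ∈ S
      · simpa [ht, eq_comm] using this
      · simp [ht]
    have hsum := he.sum_type hf (hdisj.mono
      (Submodule.span_le.mpr (by rintro _ ⟨k, rfl⟩; exact (e k).2))
      (Submodule.span_le.mpr (by rintro _ ⟨k, rfl⟩; exact (f k).2)))
    have heq : (fun k => (WithLp.toLp 2 fun t =>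
        x₀ (Sum.elim (fun _ => a) (fun _ => b) k t) * (Sum.elim v w k) t :
          EuclideanSpace ℝ (Fin n))) = Sum.elim (fun k => ↑(e k)) fun k => ↑(f k) := by
      ext k t
      rcases k with k | k
      · simp [← hv, ha]
      · simp [← hw, hb]
    rw [heq]
    exact hsum
  filter_upwards [ae_linearIndependent_smul _ _ _ hLI] with x hx
  set Z := V.map (diagMap (x ∘ a)) ⊔ W.map (diagMap (x ∘ b))
  have hmem : ∀ k, (WithLp.toLp 2 fun t =>
      x (Sum.elim (fun _ => a) (fun _ => b) k t) * (Sum.elim v w k) t :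
        EuclideanSpace ℝ (Fin n)) ∈ Z := by
    rintro (k | k)
    · exact Submodule.mem_sup_left (Submodule.mem_map_of_mem (hvV k))
    · exact Submodule.mem_sup_right (Submodule.mem_map_of_mem (hwW k))
  have hZ : LinearIndependent ℝ fun k => (⟨_, hmem k⟩ : Z) :=
    LinearIndependent.of_comp Z.subtype hx
  simpa [coordRank] using hZ.fintype_card_le_finrank

/-! ### Decodability as linear independence. -/

namespace NetworkTopology

variable {K : ℕ} {T : NetworkTopology K} {P : Measure (ChannelRealization K)}

theorem colspan_channelMatrix_mul (h : ChannelRealization K) {n m : ℕ} (i j : Fin K)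
    (B : Matrix (Fin n) (Fin m) ℝ) :
    colspan (channelMatrix h n i j * B) = (colspan B).map (diagMap fun t => h i j t) :=
  colspan_diagonal_mul _ _

/-- The kernel of the projection is the interference space. By rank-nullity the image has the full
dimension `m j` exactly when nothing is lost, neither in the precoded space nor in the projection.
-/
theorem decodable_iff (h : ChannelRealization K) {n : ℕ} {m : Fin K → ℕ}
    (B : (i : Fin K) → Matrix (Fin n) (Fin (m i)) ℝ) (j : Fin K) :
    T.Decodable h B j ↔
      Module.finrank ℝ (colspan (channelMatrix h n j j * B j)) = m j ∧
        Disjoint (colspan (channelMatrix h n j j * B j)) (T.interferenceSpace h B j) := by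
  unfold Decodable
  set V := colspan (channelMatrix h n j j * B j)
  set W := T.interferenceSpace h B j
  set p := (Wᗮ.starProjection : EuclideanSpace ℝ (Fin n) →ₗ[ℝ] EuclideanSpace ℝ (Fin n))
  have hker : ∀ v, p v = 0 ↔ v ∈ W := by
    intro v
    have := Submodule.ker_starProjection Wᗮ
    rw [Submodule.orthogonal_orthogonal] at this
    rw [← this]
    rfl
  have hle : Module.finrank ℝ V ≤ m j := finrank_colspan_le _
  have hrn := LinearMap.finrank_range_add_finrank_ker (p.domRestrict V)
  rw [LinearMap.range_domRestrict] at hrn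
  have hdisj : Module.finrank ℝ (LinearMap.ker (p.domRestrict V)) = 0 ↔ Disjoint V W := by
    rw [Submodule.finrank_eq_zero, LinearMap.ker_eq_bot', Submodule.disjoint_def]
    constructor
    · intro H v hv hvW
      exact congrArg Subtype.val (H ⟨v, hv⟩ ((hker v).mpr hvW))
    · intro H v hv
      exact Subtype.ext (H v v.2 ((hker v).mp hv))
  rw [← hdisj]
  omega

theorem map_le_interferenceSpace (h : ChannelRealization K) {n : ℕ} {m : Fin K → ℕ}
    (B : (i : Fin K) → Matrix (Fin n) (Fin (m i)) ℝ) {i j : Fin K} (hij : i ≠ j)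
    (hc : T.Conn i j) :
    (colspan (B i)).map (diagMap fun t => h i j t) ≤ T.interferenceSpace h B j := by
  rw [← colspan_channelMatrix_mul]
  exact le_biSup (fun i => colspan (channelMatrix h n i j * B i))
    (show i ∈ T.interferers j from ⟨hij, hc⟩)

theorem IsContinuousLaw.ae_ne_zero (hP : T.IsContinuousLaw P) (n : ℕ) :
    ∀ᵐ h ∂P, ∀ i j, T.Conn i j → ∀ t : Fin n, h i j t ≠ 0 := by
  have : ∀ᵐ x : T.Link × Fin n → ℝ, ∀ p, x p ≠ 0 := by
    rw [ae_all_iff]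
    intro p
    filter_upwards [MvPolynomial.ae_eval_ne_zero (MvPolynomial.X p : MvPolynomial _ ℝ)
      (MvPolynomial.X_ne_zero p)] with x hx
    simpa using hx
  filter_upwards [hP.ae_link this] with h hh i j hc t
  exact hh (⟨(i, j), hc⟩, t)

theorem IsContinuousLaw.ae_coordRank_add_le (hP : T.IsContinuousLaw P) {n : ℕ}
    (V : Fin K → Submodule ℝ (EuclideanSpace ℝ (Fin n))) :
    ∀ᵐ h ∂P, ∀ i s k, i ≠ s → T.Conn i k → T.Conn s k → ∀ S,
      coordRank (V i) S + coordRank (V s) Sᶜ ≤ Module.finrank ℝ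
        ↥((V i).map (diagMap fun t => h i k t) ⊔ (V s).map (diagMap fun t => h s k t)) := by
  classical
  simp only [ae_all_iff]
  intro i s k his hi hs S
  let a : Fin n → T.Link × Fin n := fun t => (⟨(i, k), hi⟩, t)
  let b : Fin n → T.Link × Fin n := fun t => (⟨(s, k), hs⟩, t)
  -- Since `i ≠ s`, the two links carry different variables, so both indicator scalings can be
  -- prescribed at once.
  have h := ae_coordRank_add_le_finrank_sup (V i) (V s) a b S
    (fun p => if p.1.1.1 = i then (if p.2 ∈ S then 1 else 0) else (if p.2 ∈ Sᶜ then 1 else 0))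
    (fun t => by simp [a]) (fun t => by simp [b, his.symm])
  exact hP.ae_link h

end NetworkTopology

/-! ### Achievability with two time slots. -/

namespace NetworkTopology

variable {K : ℕ} {T : NetworkTopology K} {P : Measure (ChannelRealization K)}

/-- Transmitter `i` interferes at some receiver together with another interferer. The links from
such transmitters to other receivers are the arcs of the reduced conflict graph. -/
def HasCompetitor (T : NetworkTopology K) (i : Fin K) : Prop :=
  ∃ s k : Fin K, s ≠ i ∧ k ≠ i ∧ s ≠ k ∧ T.Conn i k ∧ T.Conn s k

theorem isBipartite_reducedConflictGraph_iff :
    T.reducedConflictGraph.IsBipartite ↔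
      ∃ c : Fin K → Fin 2, ∀ i j, T.reducedConflictGraph.Adj i j → c i ≠ c j := by
  constructor
  · rintro ⟨c⟩
    exact ⟨c, fun i j hij => c.valid ⟨hij.1, Or.inl hij⟩⟩
  · rintro ⟨c, hc⟩
    refine ⟨SimpleGraph.Coloring.mk c ?_⟩
    rintro i j ⟨-, h | h⟩
    · exact hc i j h
    · exact (hc j i h).symm

open Classical in
/-- One symbol in two time slots: a transmitter with competitors uses only the slot given by its
colour, any other transmitter repeats its symbol. -/
noncomputable def twoSlotPrecoder (T : NetworkTopology K) (c : Fin K → Fin 2) (i : Fin K) :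
    Matrix (Fin 2) (Fin 1) ℝ :=
  fun t _ => if T.HasCompetitor i ∧ t ≠ c i then 0 else 1

/-- The signal of transmitter `i` at receiver `j` under `twoSlotPrecoder`. -/
noncomputable def twoSlotSignal (T : NetworkTopology K) (c : Fin K → Fin 2)
    (h : ChannelRealization K) (i j : Fin K) : EuclideanSpace ℝ (Fin 2) :=
  WithLp.toLp 2 fun t => h i j t * T.twoSlotPrecoder c i t 0

theorem colspan_twoSlotPrecoder (c : Fin K → Fin 2) (h : ChannelRealization K) (i j : Fin K) :
    colspan (channelMatrix h 2 i j * T.twoSlotPrecoder c i) =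
      Submodule.span ℝ {T.twoSlotSignal c h i j} := by
  rw [colspan, Set.range_unique]
  congr 2
  ext t
  simp [channelMatrix, Matrix.diagonal_mul, twoSlotSignal]

theorem decodable_twoSlotPrecoder {c : Fin K → Fin 2} {h : ChannelRealization K} {j : Fin K}
    (w : EuclideanSpace ℝ (Fin 2))
    (hw : ∀ i, i ≠ j → T.Conn i j → T.twoSlotSignal c h i j ∈ Submodule.span ℝ {w})
    (hdet : T.twoSlotSignal c h j j 0 * w 1 ≠ T.twoSlotSignal c h j j 1 * w 0) :
    T.Decodable h (m := fun _ => 1) (T.twoSlotPrecoder c) j := by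
  have hnot : T.twoSlotSignal c h j j ∉ Submodule.span ℝ {w} := by
    intro hu
    obtain ⟨a, ha⟩ := Submodule.mem_span_singleton.mp hu
    apply hdet
    rw [← ha]
    simp only [PiLp.smul_apply, smul_eq_mul]
    ring
  have hne : T.twoSlotSignal c h j j ≠ 0 := fun h0 => hnot (h0 ▸ Submodule.zero_mem _)
  rw [decodable_iff, colspan_twoSlotPrecoder]
  refine ⟨finrank_span_singleton hne, ?_⟩
  refine Disjoint.mono_right (b := T.interferenceSpace h (T.twoSlotPrecoder c) j)
    (c := Submodule.span ℝ {w}) ?_ ((Submodule.disjoint_span_singleton' hne).mpr hnot).symm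
  refine iSup₂_le fun i hi => ?_
  rw [colspan_twoSlotPrecoder, Submodule.span_singleton_le_iff_mem]
  exact hw i hi.1 hi.2

/-- Separates two signals that are both repeated over the two slots. -/
theorem IsContinuousLaw.ae_mul_ne_mul (hP : T.IsContinuousLaw P) :
    ∀ᵐ h ∂P, ∀ i j, i ≠ j → T.Conn i j → h j j 0 * h i j 1 ≠ h j j 1 * h i j 0 := by
  simp only [ae_all_iff]
  intro i j hij hc
  let a (t : Fin 2) : T.Link × Fin 2 := (⟨(j, j), T.direct j⟩, t)
  let b (t : Fin 2) : T.Link × Fin 2 := (⟨(i, j), hc⟩, t)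
  classical
  have hp : (MvPolynomial.X (a 0) * MvPolynomial.X (b 1) -
      MvPolynomial.X (a 1) * MvPolynomial.X (b 0) : MvPolynomial (T.Link × Fin 2) ℝ) ≠ 0 := by
    intro h0
    have := congrArg (MvPolynomial.eval fun p => if p = a 0 ∨ p = b 1 then 1 else 0) h0
    simp [a, b, hij, hij.symm] at this
  have h := hP.ae_link (MvPolynomial.ae_eval_ne_zero _ hp)
  filter_upwards [h] with h hh
  simpa [a, b, sub_eq_zero] using hh

theorem ldofAchievable_half {𝓛 : Set (Measure (ChannelRealization K))}
    (hcont : ∀ P ∈ 𝓛, T.IsContinuousLaw P) (hbip : T.reducedConflictGraph.IsBipartite) :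
    T.LDoFAchievable 𝓛 fun _ => (1 / 2 : ℝ) := by
  obtain ⟨c, hc⟩ := isBipartite_reducedConflictGraph_iff.mp hbip
  refine ⟨2, fun _ => 1, T.twoSlotPrecoder c, by norm_num, by norm_num, fun P hP => ?_⟩
  filter_upwards [(hcont P hP).ae_ne_zero 2, (hcont P hP).ae_mul_ne_mul] with h h0 hdet j
  have hj := h0 j j (T.direct j)
  have hj0 : h j j 0 ≠ 0 := by simpa using hj 0
  have hj1 : h j j 1 ≠ 0 := by simpa using hj 1
  -- If all interferers have competitors, each has an arc to `j`, so all of them use only the slot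
  -- `1 - c j`, and slot `c j` is clean.
  by_cases hall : ∀ i, i ≠ j → T.Conn i j → T.HasCompetitor i
  · refine decodable_twoSlotPrecoder (EuclideanSpace.single (1 - c j) 1) ?_ ?_
    · intro i hij hconn
      have hcomp := hall i hij hconn
      have hci : c i = 1 - c j := by
        have := hc i j ⟨hij, hconn, hcomp⟩
        omega
      refine Submodule.mem_span_singleton.mpr ⟨h i j (c i : Fin 2), ?_⟩
      ext t
      by_cases ht : t = c i
      · subst ht
        simp [twoSlotSignal, twoSlotPrecoder, ← hci]
      · simp [twoSlotSignal, twoSlotPrecoder, ← hci, ht, hcomp]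
    · have hcj : c j = 0 ∨ c j = 1 := by omega
      rcases hcj with h' | h' <;> simp [twoSlotSignal, twoSlotPrecoder, h', hj0, hj1.symm]
  -- An interferer without competitors must be the only one at `j`, so the interference is one line,
  -- with both coordinates nonzero.
  · push Not at hall
    obtain ⟨i, hij, hconn, hcomp⟩ := hall
    refine decodable_twoSlotPrecoder (T.twoSlotSignal c h i j) ?_ ?_
    · intro i' hij' hconn'
      by_cases hii : i' = i
      · subst hii
        exact Submodule.mem_span_singleton_self _
      · exact absurd ⟨i', j, hii, hij.symm, hij', hconn, hconn'⟩ hcomp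
    · have hi := h0 i j hconn
      have hi0 : h i j 0 ≠ 0 := by simpa using hi 0
      have hi1 : h i j 1 ≠ 0 := by simpa using hi 1
      have hd := hdet i j hij hconn
      by_cases hcj : T.HasCompetitor j
      · have hcj' : c j = 0 ∨ c j = 1 := by omega
        rcases hcj' with h' | h' <;>
          simp [twoSlotSignal, twoSlotPrecoder, h', hj0, hj1, hi0, hi1, hcomp, hcj]
      · simpa [twoSlotSignal, twoSlotPrecoder, hcomp, hcj] using hd

end NetworkTopology

/-! ### Consequences of alignment for bases. -/

section Alignment

variable {n m δ : ℕ} {V W : Submodule ℝ (EuclideanSpace ℝ (Fin n))} {U U' : Finset (Fin n)}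

/-- The hypothesis `hVW` is what a receiver hearing both spaces as interference imposes: their
generic sum leaves room for `m` desired dimensions. -/
theorem coordRank_compl_le_of_aligned (hn : n = 2 * m + δ)
    (hVW : ∀ S, coordRank V S + coordRank W Sᶜ + m ≤ n) (hU : coordRank V U = m) :
    coordRank W Uᶜ ≤ δ := by
  have := hVW U
  omega

/-- If two subspaces of dimension `m` always overlap as much as possible under generic scalings,
then each of them nearly is the coordinate subspace of any of its bases. -/
theorem coordRank_compl_self_le_of_aligned (hn : n = 2 * m + δ) (hW : Module.finrank ℝ W = m)
    (hVW : ∀ S, coordRank V S + coordRank W Sᶜ + m ≤ n) (hU : coordRank V U = m) :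
    coordRank V Uᶜ ≤ 2 * δ := by
  have h1 := coordRank_compl_le_of_aligned hn hVW hU
  have h2 := coordRank_union_le W U Uᶜ
  rw [Finset.union_compl, coordRank_univ, hW] at h2
  -- As `W` has rank at least `m - δ` on `U`, the basis `J` of `W` extending `I` adds at most `δ`
  -- slots. Since `V` has rank at most `δ` on `Jᶜ`, its rank on `Uᶜ ⊆ Jᶜ ∪ (J \ I)` is at most `2 *
  -- δ`.
  obtain ⟨I, hIU, hI, hI'⟩ := exists_basis W U
  obtain ⟨J, hIJ, -, hJ, hJ'⟩ := exists_basis_superset hI (Finset.subset_univ I)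
  rw [coordRank_univ, hW] at hJ'
  have h3 := hVW Jᶜ
  rw [compl_compl] at h3
  have h4 : Uᶜ ⊆ Jᶜ ∪ (J \ I) := by
    intro t ht
    simp only [Finset.mem_union, Finset.mem_compl, Finset.mem_sdiff] at ht ⊢
    have := fun h => ht (hIU h)
    tauto
  have h5 := (coordRank_mono V h4).trans (coordRank_union_le V _ _)
  have h6 := coordRank_le_card V (J \ I)
  have h7 := Finset.card_sdiff_add_card_eq_card hIJ
  omega

/-- The disagreement set is the symmetric difference, whose two halves have equal size because the
sets do. -/
theorem card_filter_iff_add (hU : U.card = m) (hU' : U'.card = m) :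
    (Finset.univ.filter fun t => t ∈ U ↔ t ∈ U').card + 2 * (U' \ U).card = n ∧
      (Finset.univ.filter fun t => ¬(t ∈ U ↔ t ∈ U')).card = 2 * (U' \ U).card := by
  have h1 : (Finset.univ.filter fun t => ¬(t ∈ U ↔ t ∈ U')) = (U \ U') ∪ (U' \ U) := by
    ext t
    simp only [Finset.mem_filter, Finset.mem_univ, true_and, Finset.mem_union, Finset.mem_sdiff]
    tauto
  have h2 : (Finset.univ.filter fun t => ¬(t ∈ U ↔ t ∈ U')).card = 2 * (U' \ U).card := by
    rw [h1, Finset.card_union_of_disjoint, Finset.card_sdiff_comm (hU.trans hU'.symm), two_mul]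
    exact disjoint_sdiff_sdiff
  refine ⟨?_, h2⟩
  rw [← h2, Finset.card_filter_add_card_filter_not, Finset.card_univ, Fintype.card_fin]

/-- Nearly coordinate subspaces with linearly independent scalings have nearly complementary
supports. -/
theorem card_filter_iff_le (hn : n = 2 * m + δ) {x y : Fin n → ℝ}
    (hxy : Module.finrank ℝ ↥(V.map (diagMap x) ⊔ W.map (diagMap y)) = 2 * m)
    (hU : U.card = m) (hVU : coordRank V Uᶜ ≤ 2 * δ)
    (hU' : U'.card = m) (hWU' : coordRank W U'ᶜ ≤ 2 * δ) :
    (Finset.univ.filter fun t => t ∈ U ↔ t ∈ U').card ≤ 9 * δ := by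
  -- This gives `2 * m ≤ m + 2 * δ + (U' \ U).card + 2 * δ`, so at most `2 * m + δ - 2 * (m - 4 * δ)
  -- = 9 * δ` slots agree.
  have h1 := finrank_sup_map_diagMap_le V W x y U
  have h2 : Uᶜ ⊆ (U' \ U) ∪ U'ᶜ := by
    intro t ht
    simp only [Finset.mem_union, Finset.mem_compl, Finset.mem_sdiff] at ht ⊢
    tauto
  have h3 := (coordRank_mono W h2).trans (coordRank_union_le W _ _)
  have h4 := coordRank_le_card W (U' \ U)
  have h5 := (card_filter_iff_add hU hU').1
  omega

/-- The set `U' \ U` is independent for `W`, being part of the basis `U'`, yet lies in `Uᶜ`, where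
`W` has rank at most `δ`. -/
theorem card_filter_not_iff_le (hU : U.card = m) (hU' : U'.card = m) (hWU' : coordRank W U' = m)
    (hWU : coordRank W Uᶜ ≤ δ) :
    (Finset.univ.filter fun t => ¬(t ∈ U ↔ t ∈ U')).card ≤ 2 * δ := by
  have h1 := coordRank_eq_card_of_subset (hWU'.trans hU'.symm)
    (Finset.sdiff_subset : U' \ U ⊆ U')
  have h2 : coordRank W (U' \ U) ≤ coordRank W Uᶜ := coordRank_mono W fun t ht =>
    Finset.mem_compl.mpr (Finset.mem_sdiff.mp ht).2
  have h3 := (card_filter_iff_add hU hU').2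
  omega

end Alignment

/-! ### The converse: a good time slot gives a 2-colouring. -/

namespace NetworkTopology

variable {K : ℕ} {T : NetworkTopology K} {𝓛 : Set (Measure (ChannelRealization K))}

theorem LDoFAchievable.le_one {P : Measure (ChannelRealization K)} (hP : P ∈ 𝓛)
    (hcP : T.IsContinuousLaw P) {d : Fin K → ℝ} (hd : T.LDoFAchievable 𝓛 d) (i : Fin K) :
    d i ≤ 1 := by
  obtain ⟨n, m, B, hn, hdm, hB⟩ := hd
  have := hcP.isProbabilityMeasure
  obtain ⟨h, hh⟩ := (hB P hP).exists
  have h1 : m i ≤ n := by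
    have h2 := hh i
    unfold Decodable at h2
    rw [← h2]
    simpa using Submodule.finrank_le ((colspan (channelMatrix h n i i * B i)).map
      ((T.interferenceSpace h B i)ᗮ.starProjection :
        EuclideanSpace ℝ (Fin n) →ₗ[ℝ] EuclideanSpace ℝ (Fin n)))
  rw [hdm i, div_le_one (by exact_mod_cast hn)]
  exact_mod_cast h1

theorem exists_slot_of_card_lt {n b : ℕ} (F : Fin K → Fin K → Finset (Fin n))
    (hF : ∀ i j, (F i j).card ≤ b) (hb : K * K * b < n) : ∃ t, ∀ i j, t ∉ F i j := by
  by_contra! hc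
  have hcover : (Finset.univ : Finset (Fin n)) ⊆
      (Finset.univ : Finset (Fin K × Fin K)).biUnion fun p => F p.1 p.2 := by
    intro t _
    obtain ⟨i, j, hij⟩ := hc t
    exact Finset.mem_biUnion.mpr ⟨(i, j), Finset.mem_univ _, hij⟩
  have h1 := (Finset.card_le_card hcover).trans
    (Finset.card_biUnion_le_card_mul _ _ b fun p _ => hF p.1 p.2)
  simp at h1
  omega

/-- A time slot in which conflicting transmitters are told apart by a family of sets of slots, and
transmitters in conflict with a common one are not, gives a splitting into two classes. -/
theorem isBipartite_of_slot {n : ℕ} (U : Fin K → Finset (Fin n)) (t : Fin n)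
    (hdiff : ∀ i j, T.reducedConflictGraph.Adj i j → T.HasCompetitor j → ¬(t ∈ U i ↔ t ∈ U j))
    (hsame : ∀ i i' j, i ≠ i' → T.reducedConflictGraph.Adj i j → T.reducedConflictGraph.Adj i' j →
      (t ∈ U i ↔ t ∈ U i')) :
    T.reducedConflictGraph.IsBipartite := by
  classical
  -- Transmitters without competitors have no outgoing arcs. Each takes the colour opposite to its
  -- in-neighbours, which agree with one another by `hsame`.
  refine isBipartite_reducedConflictGraph_iff.mpr ⟨fun i => if T.HasCompetitor i then
    (if t ∈ U i then 0 else 1) else if ∃ k, T.reducedConflictGraph.Adj k i ∧ t ∈ U k then 1 else 0,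
    fun i j hij => ?_⟩
  have hi : T.HasCompetitor i := hij.2.2
  by_cases hj : T.HasCompetitor j
  · have := hdiff i j hij hj
    by_cases h1 : t ∈ U i <;> by_cases h2 : t ∈ U j <;> simp_all
  · by_cases h1 : t ∈ U i
    · have : ∃ k, T.reducedConflictGraph.Adj k j ∧ t ∈ U k := ⟨i, hij, h1⟩
      simp [hi, hj, h1, this]
    · have : ¬∃ k, T.reducedConflictGraph.Adj k j ∧ t ∈ U k := by
        rintro ⟨k, hk, hkt⟩
        by_cases hki : k = i
        · exact h1 (hki ▸ hkt)
        · exact h1 ((hsame k i j hki hk hij).mp hkt)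
      simp [hi, hj, h1, this]

/-- Subspaces that can be decoded under a generic channel with nearly half of the dimensions each
force the reduced conflict graph to be bipartite. -/
theorem isBipartite_of_aligned {n m δ : ℕ} (hn : n = 2 * m + δ) (hδ : K * K * (11 * δ) < n)
    (V : Fin K → Submodule ℝ (EuclideanSpace ℝ (Fin n))) (hV : ∀ i, Module.finrank ℝ (V i) = m)
    (hint : ∀ i s k, i ≠ s → i ≠ k → s ≠ k → T.Conn i k → T.Conn s k →
      ∀ S, coordRank (V i) S + coordRank (V s) Sᶜ + m ≤ n)
    (x : Fin K → Fin K → Fin n → ℝ)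
    (hdes : ∀ i j, i ≠ j → T.Conn i j → Module.finrank ℝ
      ↥((V i).map (diagMap (x i j)) ⊔ (V j).map (diagMap (x j j))) = 2 * m) :
    T.reducedConflictGraph.IsBipartite := by
  classical
  have hbasis : ∀ i, ∃ U : Finset (Fin n), U.card = m ∧ coordRank (V i) U = m := by
    intro i
    obtain ⟨U, -, h1, h2⟩ := exists_basis (V i) Finset.univ
    rw [coordRank_univ, hV] at h2
    exact ⟨U, by omega, h2⟩
  choose U hUc hUr using hbasis
  have hself : ∀ i, T.HasCompetitor i → coordRank (V i) (U i)ᶜ ≤ 2 * δ := by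
    rintro i ⟨s, k, hsi, hki, hsk, hi, hs⟩
    exact coordRank_compl_self_le_of_aligned hn (hV s)
      (hint i s k hsi.symm hki.symm hsk hi hs) (hUr i)
  -- The bad slots: `F₁` where the ends of an arc fail to differ, `F₂` where two transmitters with
  -- arcs to a common vertex fail to agree.
  let F₁ : Fin K → Fin K → Finset (Fin n) := fun i j =>
    if T.reducedConflictGraph.Adj i j ∧ T.HasCompetitor j then
      Finset.univ.filter fun t => t ∈ U i ↔ t ∈ U j else ∅
  let F₂ : Fin K → Fin K → Finset (Fin n) := fun i i' =>
    if i ≠ i' ∧ ∃ j, T.reducedConflictGraph.Adj i j ∧ T.reducedConflictGraph.Adj i' j then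
      Finset.univ.filter fun t => ¬(t ∈ U i ↔ t ∈ U i') else ∅
  have hF₁ : ∀ i j, (F₁ i j).card ≤ 9 * δ := by
    intro i j
    by_cases hc : T.reducedConflictGraph.Adj i j ∧ T.HasCompetitor j
    · simp only [F₁, if_pos hc]
      obtain ⟨⟨hij, hconn, hi⟩, hj⟩ := hc
      exact card_filter_iff_le hn (hdes i j hij hconn) (hUc i) (hself i hi) (hUc j) (hself j hj)
    · simp [F₁, if_neg hc]
  have hF₂ : ∀ i j, (F₂ i j).card ≤ 2 * δ := by
    intro i i'
    by_cases hc : i ≠ i' ∧ ∃ j, T.reducedConflictGraph.Adj i j ∧ T.reducedConflictGraph.Adj i' j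
    · simp only [F₂, if_pos hc]
      obtain ⟨hii, j, ⟨hij, hconn, -⟩, ⟨hij', hconn', -⟩⟩ := hc
      exact card_filter_not_iff_le (hUc i) (hUc i') (hUr i')
        (coordRank_compl_le_of_aligned hn (hint i i' j hii hij hij' hconn hconn') (hUr i))
    · simp [F₂, if_neg hc]
  obtain ⟨t, ht⟩ := exists_slot_of_card_lt (fun i j => F₁ i j ∪ F₂ i j) (b := 11 * δ)
    (fun i j => (Finset.card_union_le _ _).trans (by
      have := hF₁ i j
      have := hF₂ i j
      omega)) hδ
  refine isBipartite_of_slot U t (fun i j hij hj h => ?_) fun i i' j hii hij hij' => ?_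
  · refine ht i j (Finset.mem_union_left _ ?_)
    simp only [F₁, if_pos (And.intro hij hj)]
    simpa using h
  · by_contra hne
    refine ht i i' (Finset.mem_union_right _ ?_)
    have hc : i ≠ i' ∧ ∃ j, T.reducedConflictGraph.Adj i j ∧ T.reducedConflictGraph.Adj i' j :=
      ⟨hii, j, hij, hij'⟩
    simp only [F₂, if_pos hc]
    simpa using hne

/-- With `d = m / n` we have `δ / n = 1 - 2 * d`, so the margin `1 / (22 * K * K)` is exactly `K * K
* (11 * δ) < n`. -/
theorem isBipartite_of_ldofAchievable {P : Measure (ChannelRealization K)} (hP : P ∈ 𝓛)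
    (hcP : T.IsContinuousLaw P) {d : ℝ} (hd : T.LDoFAchievable 𝓛 fun _ => d)
    (hlt : 1 / 2 - 1 / (22 * (K : ℝ) * K) < d) : T.reducedConflictGraph.IsBipartite := by
  -- Without competitors there are no arcs; otherwise two interferers share a receiver, which below
  -- forces `2 * M ≤ n`.
  by_cases hcomp : ∃ i, T.HasCompetitor i
  swap
  · exact isBipartite_reducedConflictGraph_iff.mpr
      ⟨fun _ => 0, fun i j hij => absurd ⟨i, hij.2.2⟩ hcomp⟩
  obtain ⟨i₀, hi₀⟩ := hcomp
  obtain ⟨n, m, B, hn, hdm, hB⟩ := hd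
  have hn' : (0 : ℝ) < n := by exact_mod_cast hn
  have hm : ∀ i, m i = m i₀ := by
    intro i
    have h1 := (hdm i).symm.trans (hdm i₀)
    rw [div_left_inj' hn'.ne'] at h1
    exact_mod_cast h1
  set M := m i₀
  have := hcP.isProbabilityMeasure
  -- One realization that is decodable and generic suffices from here on.
  obtain ⟨h, ⟨hdecodable, h0⟩, hgen⟩ := (((hB P hP).and (hcP.ae_ne_zero n)).and
    (hcP.ae_coordRank_add_le fun i => colspan (B i))).exists
  have hdec : ∀ j, Module.finrank ℝ
      ((colspan (B j)).map (diagMap fun t : Fin n => h j j t)) = M ∧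
        Disjoint ((colspan (B j)).map (diagMap fun t : Fin n => h j j t))
          (T.interferenceSpace h B j) := by
    intro j
    have := (decodable_iff h B j).mp (hdecodable j)
    rw [colspan_channelMatrix_mul] at this
    exact ⟨this.1.trans (hm j), this.2⟩
  have hfin : ∀ i j, T.Conn i j → Module.finrank ℝ
      ((colspan (B i)).map (diagMap fun t => h i j t)) = Module.finrank ℝ (colspan (B i)) :=
    fun i j hij =>
      (LinearEquiv.finrank_eq
        (Submodule.equivMapOfInjective _ (diagMap_injective (h0 i j hij)) _)).symm
  have hV : ∀ i, Module.finrank ℝ (colspan (B i)) = M := fun i =>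
    (hfin i i (T.direct i)).symm.trans (hdec i).1
  have hint : ∀ i s k, i ≠ s → i ≠ k → s ≠ k → T.Conn i k → T.Conn s k →
      ∀ S, coordRank (colspan (B i)) S + coordRank (colspan (B s)) Sᶜ + M ≤ n := by
    intro i s k his hik hsk hi hs S
    have h1 := hgen i s k his hi hs S
    have h2 := Submodule.finrank_mono (sup_le (T.map_le_interferenceSpace h B hik hi)
      (T.map_le_interferenceSpace h B hsk hs))
    have h3 := Submodule.finrank_add_finrank_le_of_disjoint (hdec k).2
    rw [(hdec k).1, finrank_euclideanSpace_fin] at h3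
    omega
  obtain ⟨s, k, hsi, hki, hsk, hi, hs⟩ := id hi₀
  have hMn : 2 * M ≤ n := by
    have := hint i₀ s k hsi.symm hki.symm hsk hi hs Finset.univ
    rw [coordRank_univ, hV] at this
    omega
  obtain ⟨δ, hδ⟩ := Nat.exists_eq_add_of_le hMn
  have hK : (0 : ℝ) < K := by exact_mod_cast i₀.pos
  refine isBipartite_of_aligned hδ ?_ (fun i => colspan (B i)) hV hint (fun i j t => h i j t) ?_
  · have hnδ : (n : ℝ) = 2 * M + δ := by exact_mod_cast hδ
    rw [show d = M / n from hdm i₀, lt_div_iff₀ hn'] at hlt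
    have h1 : (K : ℝ) * K * (11 * δ) < n := by
      have h2 : (1 / 2 - 1 / (22 * (K : ℝ) * K)) * n * (22 * K * K) < M * (22 * K * K) := by
        gcongr
      have h3 : (1 / 2 - 1 / (22 * (K : ℝ) * K)) * n * (22 * K * K) = 11 * K * K * n - n := by
        field_simp
        ring
      rw [h3] at h2
      have h4 : 11 * (K : ℝ) * K * n = 11 * K * K * (2 * M + δ) := by rw [← hnδ]
      linarith
    exact_mod_cast h1
  · intro i j hij hconn
    have hdisj := (hdec j).2.mono_right (T.map_le_interferenceSpace h B hij hconn)
    have h1 := Submodule.finrank_sup_add_finrank_inf_eq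
      ((colspan (B i)).map (diagMap fun t : Fin n => h i j t))
      ((colspan (B j)).map (diagMap fun t : Fin n => h j j t))
    rw [hdisj.symm.eq_bot, finrank_bot, hfin i j hconn, hfin j j (T.direct j), hV, hV] at h1
    omega

end NetworkTopology

theorem theorem2 (K : ℕ) (hK : 0 < K) (T : NetworkTopology K)
    (𝓛 : Set (Measure (ChannelRealization K))) (h𝓛 : 𝓛.Nonempty)
    (hcont : ∀ P ∈ 𝓛, T.IsContinuousLaw P) :
    ((1 / 2 : ℝ) ≤ T.LDoFsym 𝓛 ↔ T.reducedConflictGraph.IsBipartite) ∧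
      ((T.LDoFAchievable 𝓛 fun _ => (1 / 2 : ℝ)) ↔ T.reducedConflictGraph.IsBipartite) := by
  obtain ⟨P, hP⟩ := h𝓛
  have hbip : T.reducedConflictGraph.IsBipartite → T.LDoFAchievable 𝓛 fun _ => (1 / 2 : ℝ) :=
    T.ldofAchievable_half hcont
  have hK' : (0 : ℝ) < 1 / (22 * (K : ℝ) * K) := by positivity
  refine ⟨⟨fun h => ?_, fun h => ?_⟩, fun h => ?_, hbip⟩
  -- The real supremum of the empty set is 0, which is below one half.
  · have hne : {d : ℝ | T.LDoFAchievable 𝓛 fun _ => d}.Nonempty := by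
      rw [Set.nonempty_iff_ne_empty]
      intro hempty
      rw [NetworkTopology.LDoFsym, hempty, Real.sSup_empty] at h
      norm_num at h
    obtain ⟨d, hd, hlt⟩ := exists_lt_of_lt_csSup hne (lt_of_lt_of_le (sub_lt_self _ hK') h)
    exact T.isBipartite_of_ldofAchievable hP (hcont P hP) hd hlt
  · exact le_csSup ⟨1, fun d hd =>
      NetworkTopology.LDoFAchievable.le_one hP (hcont P hP) hd ⟨0, hK⟩⟩ (hbip h)
  · exact T.isBipartite_of_ldofAchievable hP (hcont P hP) h (sub_lt_self _ hK')
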